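/- Consider $N$ dynamically decoupled agents; agent $i$ has state, input, measurement and disturbance dimensions $n_i,m_i,p_i,q_i$. Let $A,B_1,B_2,C_2,D_{21}$ be real block-diagonal matrices with diagonal blocks $A_{ii}\in\mathbb R^{n_i\times n_i}$, $B_{1_{ii}}\in\mathbb R^{n_i\times q_i}$, $B_{2_{ii}}\in\mathbb R^{n_i\times m_i}$, $C_{2_{ii}}\in\mathbb R^{p_i\times n_i}$, $D_{21_{ii}}\in\mathbb R^{p_i\times q_i}$, and let $C_1,D_{12}$ be arbitrary real matrices with $r$ rows and with $\sum_i n_i$, respectively $\sum_i m_i$, columns. Write $\left[\begin{array}{c|c}A&B\\\hline C&D\end{array}\right]=D+C(sI-A)^{-1}B$, and let \[ \mathcal P=\begin{bmatrix}\mathcal P_{11}&\mathcal P_{12}\\\mathcal P_{21}&\mathcal P_{22}\end{bmatrix} =\left[\begin{array}{c|cc}A&B_1&B_2\\\hline C_1&0&D_{12}\\C_2&D_{21}&0\end{array}\right]. \] A real square matrix is Hurwitz if all its eigenvalues have negative real part. Say that $(A,B,C,D)$ satisfies the Riccati assumptions if $D^{\mathsf T}D\succ0$, $A+BF$ is Hurwitz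 for some real $F$, and $\begin{bmatrix}A-j\omega I&B\\C&D\end{bmatrix}$ has full column rank for all $\omega\in\mathbb R$. Assume that $(A,B_2,C_1,D_{12})$ and, for every $i$, $(A_{ii}^{\mathsf T},C_{2_{ii}}^{\mathsf T},B_{1_{ii}}^{\mathsf T},D_{21_{ii}}^{\mathsf T})$ satisfy the Riccati assumptions. Let $\mathbb C_\alpha=\{s\in\mathbb C:\operatorname{Re}s>\alpha\}$. Transfer matrices are complex matrix-valued functions of $s$, identified when they agree on some $\mathbb C_\alpha$. A transfer matrix is proper if it is analytic and bounded on $\mathbb C_\alpha$ for some $\alpha>0$, and it is in $\mathcal H_\infty$ if it is (continues to) a bounded analytic function on $\mathbb C_0$. Given a directed graph on $\{1,\dots,N\}$ and a delay $\tau\ge0$, let $\mathcal S_\tau$ be the set of transfer matrices, with block $(i,j)$ of size $m_i\times p_j$, whose $(i,i)$ block is proper, whose $(i,j)$ block for $i\ne j$ is $e^{-s\tau}$ times a proper transfer matrix if there is a directed path from $j$ to $i$, and whose $(i,j)$ block for $i\neq j$ is $0$ otherwise. A controller $\mathcal K$ (internally) stabilizes $\mathcal P$ if $\begin{bmatrix}I&-\mathcal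 P_{22}\\-\mathcal K&I\end{bmatrix}$ is invertible with inverse in $\mathcal H_\infty$. For a transfer matrix $\mathcal J$ partitioned into blocks $\mathcal J_{11},\mathcal J_{12},\mathcal J_{21},\mathcal J_{22}$ put $\mathcal F_l(\mathcal J,\mathcal Q)=\mathcal J_{11}+\mathcal J_{12}\mathcal Q(I-\mathcal J_{22}\mathcal Q)^{-1}\mathcal J_{21}$. Let $F_d$ and $L_d$ be real block-diagonal matrices, with blocks of sizes $m_i\times n_i$ and $n_i\times p_i$, such that $A+B_2F_d$ and $A+L_dC_2$ are Hurwitz. Then for every $\mathcal K$ the following are equivalent: (i) $\mathcal K\in\mathcal S_\tau$ and $\mathcal K$ stabilizes $\mathcal P$. (ii) $\mathcal K=\mathcal F_l(\mathcal J,\mathcal Q)$ for some $\mathcal Q\in\mathcal H_\infty\cap\mathcal S_\tau$, where \[ \mathcal J=\left[\begin{array}{c|cc}A+B_2F_d+L_dC_2&-L_d&B_2\\\hline F_d&0&I\\-C_2&I&0\end{array}\right]. \] -/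

import Mathlib

open Matrix

noncomputable section

namespace DelayControl

/-! ### Transfer matrices -/

/-- The open right half-plane `ℂ_α = {s : Re s > α}`. -/
def halfPlane (α : ℝ) : Set ℂ := {s | α < s.re}

/-- The filter generated by the half-planes `ℂ_α`, `α → ∞`. Transfer matrices are represented by
functions `ℂ → Matrix _ _ ℂ` and are identified when they agree on some half-plane `ℂ_α`, that is,
when they agree eventually along this filter. -/
def rightInfinity : Filter ℂ := Filter.comap Complex.re Filter.atTop

/-- `G` is analytic and bounded on `ℂ_α`. Both conditions are imposed entrywise, which for matrices
of finite size is the same as using any matrix norm. -/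
def IsBoundedAnalyticOn {μ ν : Type*} (α : ℝ) (G : ℂ → Matrix μ ν ℂ) : Prop :=
  (∀ i j, DifferentiableOn ℂ (fun s => G s i j) (halfPlane α)) ∧
    ∃ C : ℝ, ∀ s ∈ halfPlane α, ∀ i j, ‖G s i j‖ ≤ C

/-- Proper transfer matrices: analytic and bounded on `ℂ_α` for some `α > 0`. -/
def IsProper {μ ν : Type*} (G : ℂ → Matrix μ ν ℂ) : Prop :=
  ∃ α : ℝ, 0 < α ∧ IsBoundedAnalyticOn α G

/-- `G ∈ H∞`: the transfer matrix `G` is (or continues analytically to) a bounded analytic function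
on the open right half-plane `ℂ_0`. -/
def IsHinf {μ ν : Type*} (G : ℂ → Matrix μ ν ℂ) : Prop :=
  ∃ G' : ℂ → Matrix μ ν ℂ, IsBoundedAnalyticOn 0 G' ∧ G =ᶠ[rightInfinity] G'

/-- A real matrix regarded as a complex one. -/
def toC {μ ν : Type*} (M : Matrix μ ν ℝ) : Matrix μ ν ℂ := M.map (fun x : ℝ => (x : ℂ))

/-- The transfer matrix `D + C (sI - A)⁻¹ B`. -/
def stateSpace {σ μ ν : Type*} [Fintype σ] [DecidableEq σ]
    (A : Matrix σ σ ℝ) (B : Matrix σ ν ℝ) (C : Matrix μ σ ℝ) (D : Matrix μ ν ℝ) :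
    ℂ → Matrix μ ν ℂ :=
  fun s => toC D + toC C * (s • (1 : Matrix σ σ ℂ) - toC A)⁻¹ * toC B

/-- The lower linear fractional transformation `G₁₁ + G₁₂ Q (I - G₂₂ Q)⁻¹ G₂₁`. -/
def lowerLFT {ζ η ω υ : Type*} [Fintype η] [DecidableEq η] [Fintype υ]
    (G : ℂ → Matrix (ζ ⊕ η) (ω ⊕ υ) ℂ) (Q : ℂ → Matrix υ η ℂ) : ℂ → Matrix ζ ω ℂ :=
  fun s => (G s).toBlocks₁₁ +
    (G s).toBlocks₁₂ * Q s * (1 - (G s).toBlocks₂₂ * Q s)⁻¹ * (G s).toBlocks₂₁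

/-- The policy `u = K y` internally stabilizes the four-block plant `P`: the transfer matrix
`[I, -P₂₂; -K, I]` is invertible and its inverse is in `H∞`. -/
def Stabilizes {ζ η ω υ : Type*} [Fintype η] [DecidableEq η] [Fintype υ] [DecidableEq υ]
    (K : ℂ → Matrix υ η ℂ) (P : ℂ → Matrix (ζ ⊕ η) (ω ⊕ υ) ℂ) : Prop :=
  (∀ᶠ s in rightInfinity, IsUnit (fromBlocks 1 (-(P s).toBlocks₂₂) (-K s) 1)) ∧
    IsHinf fun s => (fromBlocks 1 (-(P s).toBlocks₂₂) (-K s) 1)⁻¹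

/-! ### Hurwitz matrices and the Riccati assumptions -/

/-- All (complex) eigenvalues of `A` have negative real part. -/
def IsHurwitz {σ : Type*} [Fintype σ] [DecidableEq σ] (A : Matrix σ σ ℝ) : Prop :=
  ∀ z ∈ spectrum ℂ (toC A), z.re < 0

/-- `(A, B)` is stabilizable. -/
def IsStabilizable {σ ν : Type*} [Fintype σ] [DecidableEq σ] [Fintype ν]
    (A : Matrix σ σ ℝ) (B : Matrix σ ν ℝ) : Prop :=
  ∃ F : Matrix ν σ ℝ, IsHurwitz (A + B * F)

/-- The Riccati assumptions on `(A, B, C, D)`: `Dᵀ D ≻ 0`, `(A, B)` is stabilizable, and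
`[A - jωI, B; C, D]` has full column rank for all real `ω`. -/
def RiccatiAssumptions {σ μ ν : Type*} [Fintype σ] [DecidableEq σ] [Fintype μ] [Fintype ν]
    (A : Matrix σ σ ℝ) (B : Matrix σ ν ℝ) (C : Matrix μ σ ℝ) (D : Matrix μ ν ℝ) : Prop :=
  (Dᵀ * D).PosDef ∧ IsStabilizable A B ∧
    ∀ ω : ℝ, (fromBlocks (toC A - (Complex.I * (ω : ℂ)) • (1 : Matrix σ σ ℂ))
      (toC B) (toC C) (toC D)).rank = Fintype.card (σ ⊕ ν)

/-! ### The multi-agent plant -/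

/-- Coordinates of a vector partitioned into `N` pieces, the `i`-th one of dimension `d i`. -/
abbrev Idx {N : ℕ} (d : Fin N → ℕ) : Type := (i : Fin N) × Fin (d i)

/-- State-space data of `N` dynamically decoupled agents. Agent `i` has state, input, measurement
and disturbance dimensions `n i`, `m i`, `p i`, `q i`; the regulated output has dimension `r` and
may couple all agents. The fields `A`, `B₁`, `B₂`, `C₂`, `D₂₁` list the diagonal blocks. -/
structure Agents (N : ℕ) (n m p q : Fin N → ℕ) (r : ℕ) where
  A : ∀ i, Matrix (Fin (n i)) (Fin (n i)) ℝ
  B₁ : ∀ i, Matrix (Fin (n i)) (Fin (q i)) ℝ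
  B₂ : ∀ i, Matrix (Fin (n i)) (Fin (m i)) ℝ
  C₂ : ∀ i, Matrix (Fin (p i)) (Fin (n i)) ℝ
  D₂₁ : ∀ i, Matrix (Fin (p i)) (Fin (q i)) ℝ
  C₁ : Matrix (Fin r) (Idx n) ℝ
  D₁₂ : Matrix (Fin r) (Idx m) ℝ

namespace Agents

variable {N : ℕ} {n m p q : Fin N → ℕ} {r : ℕ}

/-- The four-block plant with realization `[A | B₁ B₂; C₁ | 0 D₁₂; C₂ | D₂₁ 0]`. -/
def plant (S : Agents N n m p q r) : ℂ → Matrix (Fin r ⊕ Idx p) (Idx q ⊕ Idx m) ℂ :=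
  stateSpace (blockDiagonal' S.A)
    (fromCols (blockDiagonal' S.B₁) (blockDiagonal' S.B₂))
    (fromRows S.C₁ (blockDiagonal' S.C₂))
    (fromBlocks 0 S.D₁₂ (blockDiagonal' S.D₂₁) 0)

/-- The Riccati assumptions hold for `(A, B₂, C₁, D₁₂)` and for
`(Aᵢᵢᵀ, C₂ᵢᵢᵀ, B₁ᵢᵢᵀ, D₂₁ᵢᵢᵀ)`, for every agent `i`. -/
def SystemAssumptions (S : Agents N n m p q r) : Prop :=
  RiccatiAssumptions (blockDiagonal' S.A) (blockDiagonal' S.B₂) S.C₁ S.D₁₂ ∧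
    ∀ i, RiccatiAssumptions (S.A i)ᵀ (S.C₂ i)ᵀ (S.B₁ i)ᵀ (S.D₂₁ i)ᵀ

/-- The observer-based system
`J = [A + B₂ F + L C₂ | -L B₂; F | 0 I; -C₂ | I 0]`. -/
def observerSystem (S : Agents N n m p q r)
    (F : Matrix (Idx m) (Idx n) ℝ) (L : Matrix (Idx n) (Idx p) ℝ) :
    ℂ → Matrix (Idx m ⊕ Idx p) (Idx p ⊕ Idx m) ℂ :=
  stateSpace (blockDiagonal' S.A + blockDiagonal' S.B₂ * F + L * blockDiagonal' S.C₂)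
    (fromCols (-L) (blockDiagonal' S.B₂))
    (fromRows F (-blockDiagonal' S.C₂))
    (fromBlocks 0 1 1 0)

end Agents

/-! ### Structured compensators -/

open Classical in
/-- The weight of the block `(i, j)` in the structure: `1` on the diagonal, `e^{-sτ}` if `i ≠ j` and
there is a directed path from `j` to `i`, and `0` otherwise. -/
def delayWeight {N : ℕ} (G : Digraph (Fin N)) (τ : ℝ) (s : ℂ) (i j : Fin N) : ℂ :=
  if i = j then 1
  else if Relation.TransGen G.Adj j i then Complex.exp (-s * (τ : ℂ))
  else 0

/-- The set `S_τ` of compensators whose diagonal blocks are `K_ii`, whose block `(i, j)` is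
`e^{-sτ} K_ij` for each directed path `j → i`, `j ≠ i`, and whose other blocks vanish, with all
`K_ij` proper. -/
def structured {N : ℕ} (G : Digraph (Fin N)) (τ : ℝ) (m p : Fin N → ℕ) :
    Set (ℂ → Matrix (Idx m) (Idx p) ℂ) :=
  {K | ∃ K' : ℂ → Matrix (Idx m) (Idx p) ℂ, IsProper K' ∧
    ∀ᶠ s in rightInfinity, ∀ (i j : Fin N) (a : Fin (m i)) (b : Fin (p j)),
      K s ⟨i, a⟩ ⟨j, b⟩ = delayWeight G τ s i j * K' s ⟨i, a⟩ ⟨j, b⟩}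

end DelayControl

end

open Filter Topology

namespace DelayControl

/-! ### Observer-loop identities at a fixed frequency. -/

section Algebra

variable {𝕜 σ : Type*} [Field 𝕜] [Fintype σ] [DecidableEq σ]

/-! Write `Z = sI - A` and drive the observer by a unit innovation: `Zx = BKy - L`, `y = Cx + I`.
Then `Q = Ky - Fx` is the Youla parameter, and solving the loop for `K` gives the linear fractional
formula (`ObserverLoop.controller_eq`).

If `K` stabilizes, the closed-loop inverse applied to a stable column yields `y` and, up to a stable
term, `Ky` (`ObserverLoop.fromBlocks_inv_mul`). Then `x` is the output of the stable estimator `(Z -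
LC)⁻¹` driven by `Ky` and `y`, so `Q` is in H∞. Conversely, `fromBlocks_mul_closedLoop` writes the
closed-loop inverse using only constants, `Q`, `(Z - BF)⁻¹` and `(Z - LC)⁻¹`, all stable.

Structure survives both passages because `S_τ` contains the block-diagonal constants and is closed
under sums, products and inversion of `I` minus a strictly proper member. Products work because
paths compose and `|e^{-sτ}| ≤ 1` for `Re s ≥ 0`; inverses come from a Neumann series far to the
right (`structured_one_sub_inv_smul_inv`). -/

lemma eq_inv_mul_of_mul_eq {κ : Type*} {Z : Matrix σ σ 𝕜} (hZ : IsUnit Z) {X Y : Matrix σ κ 𝕜}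
    (h : Z * X = Y) : X = Z⁻¹ * Y := by
  rw [← h, Matrix.nonsing_inv_mul_cancel_left _ _ ((Matrix.isUnit_iff_isUnit_det _).1 hZ)]

lemma mul_inv_mul_of_isUnit {κ : Type*} {Z : Matrix σ σ 𝕜} (hZ : IsUnit Z) (X : Matrix σ κ 𝕜) :
    Z * (Z⁻¹ * X) = X :=
  Matrix.mul_nonsing_inv_cancel_left _ _ ((Matrix.isUnit_iff_isUnit_det _).1 hZ)

variable {υ η : Type*} [Fintype υ] [Fintype η] [DecidableEq η]
variable {Z : Matrix σ σ 𝕜} {B : Matrix σ υ 𝕜} {C : Matrix η σ 𝕜} {F : Matrix υ σ 𝕜}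
  {L : Matrix σ η 𝕜} {K : Matrix υ η 𝕜}

/-- Signals of the observer in closed loop with `u = K y`, driven by the innovation. -/
structure ObserverLoop (Z : Matrix σ σ 𝕜) (B : Matrix σ υ 𝕜) (C : Matrix η σ 𝕜)
    (F : Matrix υ σ 𝕜) (L : Matrix σ η 𝕜) (K : Matrix υ η 𝕜)
    (x : Matrix σ η 𝕜) (y : Matrix η η 𝕜) (Q : Matrix υ η 𝕜) : Prop where
  state : Z * x = B * (K * y) - L
  output : y = C * x + 1
  param : Q = K * y - F * x

variable {x : Matrix σ η 𝕜} {y : Matrix η η 𝕜} {Q : Matrix υ η 𝕜}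

/-- Well-posedness: eliminating `x` from the loop leaves `(1 - C Z⁻¹ B K) y = 1 - C Z⁻¹ L`. -/
lemma observerLoop_of_isUnit (hZ : IsUnit Z) (h : IsUnit (1 - C * Z⁻¹ * B * K))
    (hy : y = (1 - C * Z⁻¹ * B * K)⁻¹ * (1 - C * Z⁻¹ * L))
    (hx : x = Z⁻¹ * (B * (K * y) - L)) (hQ : Q = K * y - F * x) :
    ObserverLoop Z B C F L K x y Q := by
  refine ⟨by rw [hx, mul_inv_mul_of_isUnit hZ], ?_, hQ⟩
  have h1 : (1 - C * Z⁻¹ * B * K) * y = 1 - C * Z⁻¹ * L := by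
    rw [hy, mul_inv_mul_of_isUnit h]
  rw [hx]
  simp only [Matrix.sub_mul, Matrix.mul_sub, Matrix.one_mul, Matrix.mul_assoc] at h1 ⊢
  rw [sub_eq_iff_eq_add] at h1
  conv_lhs => rw [h1]
  abel

/-- Replacing the unit innovation by `y - Cx` turns `Z` into the estimator dynamics `Z - LC`. This
makes `x` stable once `y` and `Ky` are. -/
lemma ObserverLoop.state_eq_estimator (h : ObserverLoop Z B C F L K x y Q)
    (hZ : IsUnit (Z - L * C)) : x = (Z - L * C)⁻¹ * (B * (K * y) - L * y) := by
  apply eq_inv_mul_of_mul_eq hZ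
  rw [Matrix.sub_mul, h.state]
  conv_rhs => rw [h.output]
  conv_lhs => rw [h.output]
  simp only [Matrix.mul_add, Matrix.mul_one, Matrix.mul_assoc]
  abel

/-- Substituting `Ky = Q + Fx` as well gives the state equation of `J`. -/
lemma ObserverLoop.state_eq_controller (h : ObserverLoop Z B C F L K x y Q)
    (hZ : IsUnit (Z - B * F - L * C)) :
    x = (Z - B * F - L * C)⁻¹ * (B * Q - L * y) := by
  apply eq_inv_mul_of_mul_eq hZ
  have h2 : L * y = L * C * x + L := by
    conv_lhs => rw [h.output]
    simp only [Matrix.mul_add, Matrix.mul_one, Matrix.mul_assoc]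
  rw [h2, Matrix.sub_mul, Matrix.sub_mul, h.state, h.param]
  simp only [Matrix.mul_sub, Matrix.mul_assoc]
  abel

variable [DecidableEq υ]

/-- The controller is recovered from the free parameter by the linear fractional transformation. -/
lemma ObserverLoop.controller_eq (h : ObserverLoop Z B C F L K x y Q)
    (hZ : IsUnit (Z - B * F - L * C))
    (hQ : IsUnit (1 + C * (Z - B * F - L * C)⁻¹ * B * Q)) :
    K = -(F * (Z - B * F - L * C)⁻¹ * L) + (1 + F * (Z - B * F - L * C)⁻¹ * B) * Q *
      (1 + C * (Z - B * F - L * C)⁻¹ * B * Q)⁻¹ * (1 + C * (Z - B * F - L * C)⁻¹ * L) := by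
  have hx := h.state_eq_controller hZ
  set Ψ := (Z - B * F - L * C)⁻¹
  set E := (1 + C * Ψ * B * Q)⁻¹ * (1 + C * Ψ * L) with hE
  -- This identity shows that `y` has the inverse `E`, so `K` is recovered from `Ky = Q + Fx` by
  -- multiplying by `E` on the right.
  have h1 : (1 + C * Ψ * L) * y = 1 + C * Ψ * B * Q := by
    have h2 := h.output
    rw [hx] at h2
    rw [Matrix.add_mul, Matrix.one_mul]
    conv_lhs => enter [1]; rw [h2]
    simp only [Matrix.mul_sub, Matrix.mul_assoc]
    abel
  have h3 : E * y = 1 := by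
    rw [hE, Matrix.mul_assoc, h1,
      Matrix.nonsing_inv_mul _ ((Matrix.isUnit_iff_isUnit_det _).1 hQ)]
  have h4 : y * E = 1 := mul_eq_one_comm.1 h3
  have h5 : K * y = Q + F * x := by rw [h.param]; abel
  calc K = K * (y * E) := by rw [h4, Matrix.mul_one]
    _ = Q * E + F * Ψ * B * (Q * E) - F * Ψ * L * (y * E) := by
      rw [← Matrix.mul_assoc, h5, hx]
      simp only [Matrix.mul_sub, Matrix.sub_mul, Matrix.add_mul, Matrix.mul_assoc]
      abel
    _ = _ := by
      rw [h4, hE]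
      simp only [Matrix.add_mul, Matrix.mul_assoc, Matrix.one_mul, Matrix.mul_one]
      abel

/-- The closed-loop signals in terms of the inverse of the return difference matrix. -/
lemma ObserverLoop.fromBlocks_inv_mul (h : ObserverLoop Z B C F L K x y Q) (hZ : IsUnit Z)
    (hF : IsUnit (Z - B * F))
    (hT : IsUnit (fromBlocks 1 (-(C * Z⁻¹ * B)) (-K) 1)) :
    (fromBlocks 1 (-(C * Z⁻¹ * B)) (-K) 1)⁻¹ *
      fromRows (1 - C * (Z - B * F)⁻¹ * L) (F * (Z - B * F)⁻¹ * L) =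
    fromRows y (K * y + F * (Z - B * F)⁻¹ * L) := by
  symm
  apply eq_inv_mul_of_mul_eq hT
  have hx : x = Z⁻¹ * (B * (K * y) - L) := eq_inv_mul_of_mul_eq hZ h.state
  -- State feedback read as an input to the open-loop dynamics, so that both sides involve only
  -- `Z⁻¹`.
  have hΦ : (Z - B * F)⁻¹ * L = Z⁻¹ * (L + B * (F * ((Z - B * F)⁻¹ * L))) := by
    apply eq_inv_mul_of_mul_eq hZ
    have := mul_inv_mul_of_isUnit hF L
    rw [Matrix.sub_mul, sub_eq_iff_eq_add] at this
    rw [this]; simp only [Matrix.mul_assoc]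
  rw [fromBlocks_mul_fromRows]
  congr 1
  · have hy := h.output
    rw [hx] at hy
    have h6 : C * ((Z - B * F)⁻¹ * L) =
        C * (Z⁻¹ * L) + C * (Z⁻¹ * (B * (F * ((Z - B * F)⁻¹ * L)))) := by
      conv_lhs => rw [hΦ]
      simp only [Matrix.mul_add]
    conv_lhs => enter [1]; rw [hy]
    simp only [Matrix.mul_assoc, Matrix.mul_sub, Matrix.mul_add, Matrix.one_mul, Matrix.neg_mul,
      h6]
    abel
  · simp

/-- The inverse of the return difference matrix of the controller with parameter `Q`. -/
lemma fromBlocks_mul_closedLoop (hZ : IsUnit Z) (hF : IsUnit (Z - B * F))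
    (hL : IsUnit (Z - L * C)) (hJ : IsUnit (Z - B * F - L * C))
    (hQ : IsUnit (1 + C * (Z - B * F - L * C)⁻¹ * B * Q))
    (hK : K = -(F * (Z - B * F - L * C)⁻¹ * L) + (1 + F * (Z - B * F - L * C)⁻¹ * B) * Q *
      (1 + C * (Z - B * F - L * C)⁻¹ * B * Q)⁻¹ * (1 + C * (Z - B * F - L * C)⁻¹ * L))
    {D : Matrix η η 𝕜} {U : Matrix υ η 𝕜}
    (hD : D = 1 + C * (Z - B * F)⁻¹ * (B * Q - L))
    (hU : U = F * (Z - B * F)⁻¹ * (B * Q - L) + Q) :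
    fromBlocks 1 (-(C * Z⁻¹ * B)) (-K) 1 *
      fromBlocks (D * (1 + C * (Z - L * C)⁻¹ * L)) (D * (C * (Z - L * C)⁻¹ * B))
        (U * (1 + C * (Z - L * C)⁻¹ * L)) (1 + U * (C * (Z - L * C)⁻¹ * B)) = 1 := by
  set x := (Z - B * F)⁻¹ * (B * Q - L) with hx
  have hD' : D = 1 + C * x := by rw [hD, hx, Matrix.mul_assoc]
  have hU' : U = F * x + Q := by rw [hU, hx, Matrix.mul_assoc]
  have hFx : (Z - B * F) * x = B * Q - L := mul_inv_mul_of_isUnit hF _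
  -- The same state seen through the controller dynamics and through the plant dynamics: the first
  -- yields `K * D = U`, the second `D - C Z⁻¹ B U = 1 - C Z⁻¹ L`.
  have hxJ : x = (Z - B * F - L * C)⁻¹ * (B * Q - L * D) := by
    apply eq_inv_mul_of_mul_eq hJ
    rw [Matrix.sub_mul, hFx, hD']
    simp only [Matrix.mul_add, Matrix.mul_one, Matrix.mul_assoc]
    abel
  have hxZ : x = Z⁻¹ * (B * U - L) := by
    apply eq_inv_mul_of_mul_eq hZ
    rw [Matrix.sub_mul, sub_eq_iff_eq_add] at hFx
    rw [hFx, hU']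
    simp only [Matrix.mul_add, Matrix.mul_assoc]
    abel
  have hKD : K * D = U := by
    set Ψ := (Z - B * F - L * C)⁻¹
    have h1 : (1 + C * Ψ * L) * D = 1 + C * Ψ * B * Q := by
      rw [hxJ] at hD'
      rw [Matrix.add_mul, Matrix.one_mul]
      conv_lhs => enter [1]; rw [hD']
      simp only [Matrix.mul_sub, Matrix.mul_assoc]
      abel
    rw [hK, Matrix.add_mul, Matrix.mul_assoc _ (1 + C * Ψ * L), h1,
      Matrix.mul_assoc _ (1 + C * Ψ * B * Q)⁻¹,
      Matrix.nonsing_inv_mul _ ((Matrix.isUnit_iff_isUnit_det _).1 hQ), hU']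
    conv_rhs => rw [hxJ]
    simp only [Matrix.mul_sub, Matrix.add_mul, Matrix.neg_mul, Matrix.mul_assoc, Matrix.mul_one,
      Matrix.one_mul]
    abel
  have hDU : D - C * Z⁻¹ * B * U = 1 - C * Z⁻¹ * L := by
    rw [hxZ] at hD'
    rw [hD']
    simp only [Matrix.mul_sub, Matrix.mul_assoc]
    abel
  have hinv : Z⁻¹ * L * C * (Z - L * C)⁻¹ = (Z - L * C)⁻¹ - Z⁻¹ := by
    have h2 : Z * (Z - L * C)⁻¹ = 1 + L * C * (Z - L * C)⁻¹ := by
      have := Matrix.mul_nonsing_inv _ ((Matrix.isUnit_iff_isUnit_det _).1 hL)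
      rw [Matrix.sub_mul, sub_eq_iff_eq_add] at this
      exact this
    have h3 := eq_inv_mul_of_mul_eq hZ h2
    rw [Matrix.mul_add, Matrix.mul_one] at h3
    rw [eq_sub_iff_add_eq', Matrix.mul_assoc Z⁻¹, Matrix.mul_assoc Z⁻¹]
    exact h3.symm
  -- Left coprime factorization of the plant: `1 - C Z⁻¹ L` is inverse to `1 + C (Z - LC)⁻¹ L` and
  -- turns `C (Z - LC)⁻¹ B` back into `C Z⁻¹ B`.
  have hC : (1 - C * Z⁻¹ * L) * (C * (Z - L * C)⁻¹) = C * Z⁻¹ := by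
    have : C * Z⁻¹ * L * (C * (Z - L * C)⁻¹) = C * (Z⁻¹ * L * C * (Z - L * C)⁻¹) := by
      simp only [Matrix.mul_assoc]
    rw [Matrix.sub_mul, this, hinv, Matrix.mul_sub]
    simp
  rw [fromBlocks_multiply, ← fromBlocks_one]
  congr 1
  · rw [Matrix.one_mul, Matrix.neg_mul, ← Matrix.mul_assoc, ← sub_eq_add_neg, ← Matrix.sub_mul,
      hDU, Matrix.mul_add, ← Matrix.mul_assoc, hC]
    simp
  · have : D * (C * (Z - L * C)⁻¹ * B) - C * Z⁻¹ * B * U * (C * (Z - L * C)⁻¹ * B)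
        = C * Z⁻¹ * B := by
      rw [← Matrix.sub_mul, hDU, ← Matrix.mul_assoc, hC]
    rw [sub_eq_iff_eq_add] at this
    rw [Matrix.one_mul, this, Matrix.neg_mul, Matrix.mul_add, Matrix.mul_one,
      Matrix.mul_assoc (C * Z⁻¹ * B) U]
    abel
  · rw [Matrix.neg_mul, ← Matrix.mul_assoc, hKD]; simp
  · rw [Matrix.neg_mul, ← Matrix.mul_assoc, hKD]; simp [add_comm]

end Algebra

end DelayControl

namespace DelayControl

/-! ### Half-planes far to the right. -/

section RightInfinity

lemma eventually_rightInfinity {P : ℂ → Prop} :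
    (∀ᶠ s in rightInfinity, P s) ↔ ∃ α : ℝ, 0 < α ∧ ∀ s ∈ halfPlane α, P s := by
  unfold rightInfinity
  rw [((atTop_basis_Ioi' (0 : ℝ)).comap Complex.re).eventually_iff]
  rfl

lemma halfPlane_subset {α β : ℝ} (h : α ≤ β) : halfPlane β ⊆ halfPlane α :=
  fun _ hs => lt_of_le_of_lt h hs

end RightInfinity

/-! ### Holomorphy of matrix inverses. -/

section Differentiability

variable {σ : Type*} [Fintype σ] [DecidableEq σ] {M : ℂ → Matrix σ σ ℂ} {U : Set ℂ}

lemma differentiableOn_det (h : ∀ i j, DifferentiableOn ℂ (fun s => M s i j) U) :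
    DifferentiableOn ℂ (fun s => (M s).det) U := by
  simp only [Matrix.det_apply']
  refine DifferentiableOn.fun_sum fun e _ => DifferentiableOn.const_mul ?_ _
  exact DifferentiableOn.fun_finsetProd fun i _ => h _ _

/-- Cramer's rule: each entry is a cofactor over a nonvanishing determinant. -/
lemma differentiableOn_inv (h : ∀ i j, DifferentiableOn ℂ (fun s => M s i j) U)
    (hM : ∀ s ∈ U, IsUnit (M s)) (i j : σ) :
    DifferentiableOn ℂ (fun s => (M s)⁻¹ i j) U := by
  simp only [Matrix.inv_def, Ring.inverse_eq_inv', Matrix.smul_apply, smul_eq_mul,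
    Matrix.adjugate_apply]
  refine DifferentiableOn.mul (DifferentiableOn.fun_inv (differentiableOn_det h) fun s hs =>
    ((Matrix.isUnit_iff_isUnit_det _).1 (hM s hs)).ne_zero) (differentiableOn_det fun k l => ?_)
  by_cases hk : k = j
  · subst hk; simp only [Matrix.updateRow_self]; exact differentiableOn_const _
  · simpa only [Matrix.updateRow_ne hk] using h k l

end Differentiability

/-! ### Delay weights. -/

section Weight

variable {N : ℕ} (G : Digraph (Fin N)) {τ : ℝ}

lemma delayWeight_self (s : ℂ) (i : Fin N) : delayWeight G τ s i i = 1 := by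
  simp [delayWeight]

lemma differentiable_delayWeight (i j : Fin N) :
    Differentiable ℂ fun s => delayWeight G τ s i j := by
  unfold delayWeight
  split_ifs <;> fun_prop

lemma delayWeight_ne_zero_or (i j : Fin N) :
    (∀ s, delayWeight G τ s i j ≠ 0) ∨ ∀ s, delayWeight G τ s i j = 0 := by
  unfold delayWeight
  split_ifs <;> simp

/-- The delay weights are submultiplicative along compositions of paths. -/
lemma norm_delayWeight_mul_le (hτ : 0 ≤ τ) {s : ℂ} (hs : 0 ≤ s.re) (i k j : Fin N) :
    ‖delayWeight G τ s i k‖ * ‖delayWeight G τ s k j‖ ≤ ‖delayWeight G τ s i j‖ := by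
  have he : ‖Complex.exp (-s * (τ : ℂ))‖ ≤ 1 := by
    rw [Complex.norm_exp]
    simpa using mul_nonneg hs hτ
  have h0 := norm_nonneg (Complex.exp (-s * (τ : ℂ)))
  by_cases hik : i = k
  · subst hik; simp [delayWeight_self]
  by_cases hkj : k = j
  · subst hkj; simp [delayWeight_self]
  by_cases h1 : Relation.TransGen G.Adj k i
  · by_cases h2 : Relation.TransGen G.Adj j k
    -- A cycle returns to the diagonal, where the weight is `1`; otherwise two delays are bounded by
    -- one.
    · by_cases hij : i = j
      · subst hij
        simpa [delayWeight, hik, hkj, h1, h2] using mul_le_one₀ he h0 he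
      · simpa [delayWeight, hik, hkj, hij, h1, h2, h2.trans h1] using
          mul_le_of_le_one_left h0 he
    · simp [delayWeight, hkj, h2]
  · simp [delayWeight, hik, h1]

end Weight

/-! ### The algebra `S_τ`. -/

section Structured

variable {N : ℕ} {G : Digraph (Fin N)} {τ : ℝ} {d e f : Fin N → ℕ}

/-- Membership in `S_τ` in terms of the transfer matrix itself. -/
lemma mem_structured_iff {K : ℂ → Matrix (Idx d) (Idx e) ℂ} :
    K ∈ structured G τ d e ↔ ∃ α : ℝ, 0 < α ∧
      (∀ a b, DifferentiableOn ℂ (fun s => K s a b) (halfPlane α)) ∧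
      ∃ c : ℝ, ∀ s ∈ halfPlane α, ∀ a b, ‖K s a b‖ ≤ c * ‖delayWeight G τ s a.1 b.1‖ := by
  constructor
  · rintro ⟨K', ⟨α, hα, hd, c, hc⟩, hK⟩
    obtain ⟨β, hβ, hK⟩ := eventually_rightInfinity.1 hK
    have hsub := halfPlane_subset (le_max_left α β)
    have hsub' := halfPlane_subset (le_max_right α β)
    refine ⟨max α β, lt_max_of_lt_left hα, fun a b => ?_, c, fun s hs a b => ?_⟩
    · refine DifferentiableOn.congr (((differentiable_delayWeight G (τ := τ) a.1
        b.1).differentiableOn).mul ((hd a b).mono hsub)) fun s hs => ?_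
      exact hK s (hsub' hs) a.1 b.1 a.2 b.2
    · have := hK s (hsub' hs) a.1 b.1 a.2 b.2
      rw [show K s a b = _ from this, norm_mul, mul_comm]
      exact mul_le_mul_of_nonneg_right (hc s (hsub hs) _ _) (norm_nonneg _)
  · rintro ⟨α, hα, hd, c, hc⟩
    -- The vanishing of a weight does not depend on `s`. Hence each quotient is either holomorphic
    -- or, by `x / 0 = 0`, identically zero.
    refine ⟨fun s => Matrix.of fun a b => K s a b / delayWeight G τ s a.1 b.1,
      ⟨α, hα, fun a b => ?_, |c|, fun s hs a b => ?_⟩,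
      eventually_rightInfinity.2 ⟨α, hα, fun s hs i j a b => ?_⟩⟩
    · rcases delayWeight_ne_zero_or G (τ := τ) a.1 b.1 with h | h
      · exact (hd a b).fun_div (differentiable_delayWeight G a.1 b.1).differentiableOn fun s _ => h s
      · simp only [Matrix.of_apply, h, div_zero]; exact differentiableOn_const _
    · simp only [Matrix.of_apply, norm_div]
      refine div_le_of_le_mul₀ (norm_nonneg _) (abs_nonneg _) ((hc s hs a b).trans ?_)
      exact mul_le_mul_of_nonneg_right (le_abs_self c) (norm_nonneg _)
    · rcases delayWeight_ne_zero_or G (τ := τ) i j with h | h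
      · simp only [Matrix.of_apply, mul_div_cancel₀ _ (h s)]
      · have := hc s hs ⟨i, a⟩ ⟨j, b⟩
        simp only [h, norm_zero, mul_zero, norm_le_zero_iff] at this
        rw [this, h, zero_mul]

lemma structured_congr {K K' : ℂ → Matrix (Idx d) (Idx e) ℂ} (h : K =ᶠ[rightInfinity] K')
    (hK : K' ∈ structured G τ d e) : K ∈ structured G τ d e := by
  obtain ⟨X, hX, hK⟩ := hK
  refine ⟨X, hX, ?_⟩
  filter_upwards [h, hK] with s h1 h2
  rw [h1]; exact h2

/-- Diagonal blocks have weight `1`, so any constant bound serves. Decoupling of the agents and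
block-diagonality of the gains enter here. -/
lemma structured_const {M : Matrix (Idx d) (Idx e) ℂ} (hM : ∀ a b, a.1 ≠ b.1 → M a b = 0) :
    (fun _ => M) ∈ structured G τ d e := by
  refine mem_structured_iff.2 ⟨1, one_pos, fun a b => differentiableOn_const _,
    ∑ a, ∑ b, ‖M a b‖, fun s _ a b => ?_⟩
  by_cases h : a.1 = b.1
  · rw [h, delayWeight_self, norm_one, mul_one]
    exact (Finset.single_le_sum (f := fun b => ‖M a b‖) (fun _ _ => norm_nonneg _)
      (Finset.mem_univ b)).trans (Finset.single_le_sum (f := fun a => ∑ b, ‖M a b‖)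
        (fun _ _ => Finset.sum_nonneg fun _ _ => norm_nonneg _) (Finset.mem_univ a))
  · rw [hM a b h, norm_zero]; positivity

lemma structured_one : (fun _ => (1 : Matrix (Idx d) (Idx d) ℂ)) ∈ structured G τ d d :=
  structured_const fun a b h => Matrix.one_apply_ne fun hab => h (by rw [hab])

lemma structured_blockDiagonal' (M : ∀ i, Matrix (Fin (d i)) (Fin (e i)) ℝ) :
    (fun _ => toC (blockDiagonal' M)) ∈ structured G τ d e :=
  structured_const fun a b h => by
    simp [toC, Matrix.blockDiagonal'_apply, h]

lemma structured_add {X Y : ℂ → Matrix (Idx d) (Idx e) ℂ} (hX : X ∈ structured G τ d e)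
    (hY : Y ∈ structured G τ d e) : (fun s => X s + Y s) ∈ structured G τ d e := by
  obtain ⟨α, hα, hd, c, hc⟩ := mem_structured_iff.1 hX
  obtain ⟨β, hβ, hd', c', hc'⟩ := mem_structured_iff.1 hY
  have h1 := halfPlane_subset (le_max_left α β)
  have h2 := halfPlane_subset (le_max_right α β)
  refine mem_structured_iff.2 ⟨max α β, lt_max_of_lt_left hα, fun a b =>
    ((hd a b).mono h1).add ((hd' a b).mono h2), c + c', fun s hs a b => ?_⟩
  rw [add_mul]
  exact norm_add_le_of_le (hc s (h1 hs) a b) (hc' s (h2 hs) a b)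

/-- The half-plane `Re s > 1` is chosen so that `g = s⁻¹` qualifies. -/
lemma structured_smul {g : ℂ → ℂ} {X : ℂ → Matrix (Idx d) (Idx e) ℂ}
    (hg : DifferentiableOn ℂ g (halfPlane 1)) (hg1 : ∀ s ∈ halfPlane 1, ‖g s‖ ≤ 1)
    (hX : X ∈ structured G τ d e) : (fun s => g s • X s) ∈ structured G τ d e := by
  obtain ⟨α, hα, hd, c, hc⟩ := mem_structured_iff.1 hX
  have h1 := halfPlane_subset (le_max_left α 1)
  have h2 := halfPlane_subset (le_max_right α 1)
  refine mem_structured_iff.2 ⟨max α 1, lt_max_of_lt_left hα, fun a b =>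
    (hg.mono h2).mul ((hd a b).mono h1), c, fun s hs a b => ?_⟩
  rw [Matrix.smul_apply, smul_eq_mul, norm_mul]
  exact (mul_le_of_le_one_left (norm_nonneg _) (hg1 s (h2 hs))).trans (hc s (h1 hs) a b)

lemma structured_inv_smul {X : ℂ → Matrix (Idx d) (Idx e) ℂ} (hX : X ∈ structured G τ d e) :
    (fun s => s⁻¹ • X s) ∈ structured G τ d e := by
  have hs1 : ∀ s ∈ halfPlane 1, 1 ≤ ‖s‖ := fun s hs =>
    (le_of_lt hs).trans (Complex.re_le_norm s)
  refine structured_smul (differentiableOn_id.fun_inv fun s hs => ?_) (fun s hs => ?_) hX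
  · exact norm_pos_iff.1 (one_pos.trans_le (hs1 s hs))
  · rw [norm_inv]; exact inv_le_one_of_one_le₀ (hs1 s hs)

lemma structured_neg {X : ℂ → Matrix (Idx d) (Idx e) ℂ} (hX : X ∈ structured G τ d e) :
    (fun s => -X s) ∈ structured G τ d e := by
  simpa using structured_smul (g := fun _ => -1) (differentiableOn_const _) (by simp) hX

lemma structured_sub {X Y : ℂ → Matrix (Idx d) (Idx e) ℂ} (hX : X ∈ structured G τ d e)
    (hY : Y ∈ structured G τ d e) : (fun s => X s - Y s) ∈ structured G τ d e := by
  simpa only [sub_eq_add_neg] using structured_add hX (structured_neg hY)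

/-- Submultiplicativity absorbs the intermediate index; summing over it costs the factor
`Fintype.card (Idx e)`. -/
lemma norm_mul_apply_le_delayWeight (hτ : 0 ≤ τ) {s : ℂ} (hs : 0 ≤ s.re) {c c' : ℝ}
    {X : Matrix (Idx d) (Idx e) ℂ} {Y : Matrix (Idx e) (Idx f) ℂ}
    (hX : ∀ a b, ‖X a b‖ ≤ c * ‖delayWeight G τ s a.1 b.1‖)
    (hY : ∀ a b, ‖Y a b‖ ≤ c' * ‖delayWeight G τ s a.1 b.1‖) (hc : 0 ≤ c) (hc' : 0 ≤ c')
    (a : Idx d) (b : Idx f) :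
    ‖(X * Y) a b‖ ≤ Fintype.card (Idx e) * c * c' * ‖delayWeight G τ s a.1 b.1‖ := by
  rw [Matrix.mul_apply]
  calc _ ≤ ∑ k : Idx e, c * c' * ‖delayWeight G τ s a.1 b.1‖ := by
        refine norm_sum_le_of_le _ fun k _ => ?_
        rw [norm_mul]
        calc _ ≤ (c * ‖delayWeight G τ s a.1 k.1‖) * (c' * ‖delayWeight G τ s k.1 b.1‖) :=
              mul_le_mul (hX a k) (hY k b) (norm_nonneg _) (by positivity)
          _ = c * c' * (‖delayWeight G τ s a.1 k.1‖ * ‖delayWeight G τ s k.1 b.1‖) := by ring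
          _ ≤ _ := mul_le_mul_of_nonneg_left (norm_delayWeight_mul_le G hτ hs _ _ _)
              (by positivity)
    _ = _ := by simp; ring

lemma structured_mul (hτ : 0 ≤ τ) {X : ℂ → Matrix (Idx d) (Idx e) ℂ}
    {Y : ℂ → Matrix (Idx e) (Idx f) ℂ} (hX : X ∈ structured G τ d e)
    (hY : Y ∈ structured G τ e f) : (fun s => X s * Y s) ∈ structured G τ d f := by
  obtain ⟨α, hα, hd, c, hc⟩ := mem_structured_iff.1 hX
  obtain ⟨β, hβ, hd', c', hc'⟩ := mem_structured_iff.1 hY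
  have h1 := halfPlane_subset (le_max_left α β)
  have h2 := halfPlane_subset (le_max_right α β)
  refine mem_structured_iff.2 ⟨max α β, lt_max_of_lt_left hα, fun a b => ?_,
    Fintype.card (Idx e) * |c| * |c'|, fun s hs a b => ?_⟩
  · simp only [Matrix.mul_apply]
    exact DifferentiableOn.fun_sum fun k _ => ((hd a k).mono h1).mul ((hd' k b).mono h2)
  · refine norm_mul_apply_le_delayWeight hτ (hα.trans (h1 hs)).le (fun a b => ?_) (fun a b => ?_)
      (abs_nonneg _) (abs_nonneg _) a b
    · exact (hc s (h1 hs) a b).trans (mul_le_mul_of_nonneg_right (le_abs_self _) (norm_nonneg _))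
    · exact (hc' s (h2 hs) a b).trans (mul_le_mul_of_nonneg_right (le_abs_self _) (norm_nonneg _))

/-- Neumann series estimate for a matrix with small weighted entries. -/
lemma isUnit_one_sub_and_norm_inv_le (hτ : 0 ≤ τ) {s : ℂ} (hs : 0 ≤ s.re)
    {X : Matrix (Idx d) (Idx d) ℂ} {c : ℝ} (hc : 0 ≤ c) (hc1 : Fintype.card (Idx d) * c ≤ 1 / 2)
    (hX : ∀ a b, ‖X a b‖ ≤ c * ‖delayWeight G τ s a.1 b.1‖) :
    IsUnit (1 - X) ∧
      ∀ a b, ‖(1 - X)⁻¹ a b‖ ≤ 2 * ‖delayWeight G τ s a.1 b.1‖ := by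
  have hone : ∀ a b : Idx d, ‖(1 : Matrix (Idx d) (Idx d) ℂ) a b‖ ≤
      ‖delayWeight G τ s a.1 b.1‖ := by
    intro a b
    by_cases h : a = b
    · subst h; simp [delayWeight_self]
    · simp [Matrix.one_apply_ne h]
  -- Each multiplication by `X` costs at most `card * c ≤ 1/2`, while the weight stays the same.
  have hpow : ∀ k : ℕ, ∀ a b, ‖(X ^ k) a b‖ ≤ (1 / 2) ^ k * ‖delayWeight G τ s a.1 b.1‖ := by
    intro k
    induction k with
    | zero => simpa using hone
    | succ k ih =>
      intro a b
      rw [pow_succ]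
      refine (norm_mul_apply_le_delayWeight hτ hs ih hX (by positivity) hc a b).trans ?_
      refine mul_le_mul_of_nonneg_right ?_ (norm_nonneg _)
      calc _ = (1 / 2) ^ k * (Fintype.card (Idx d) * c) := by ring
        _ ≤ (1 / 2) ^ k * (1 / 2) := by gcongr
        _ = _ := (pow_succ _ _).symm
  have hlim : Tendsto (fun k => X ^ k) atTop (𝓝 0) := by
    refine tendsto_pi_nhds.2 fun a => tendsto_pi_nhds.2 fun b => ?_
    refine squeeze_zero_norm (fun k => hpow k a b) ?_
    have := tendsto_pow_atTop_nhds_zero_of_lt_one (r := (1 / 2 : ℝ)) (by norm_num) (by norm_num)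
    simpa using this.mul_const ‖delayWeight G τ s a.1 b.1‖
  -- A kernel vector of `1 - X` is fixed by every `X ^ k`, hence zero in the limit.
  have hunit : IsUnit (1 - X) := by
    rw [Matrix.isUnit_iff_isUnit_det, isUnit_iff_ne_zero]
    intro h0
    obtain ⟨v, hv, hXv⟩ := Matrix.exists_mulVec_eq_zero_iff.2 h0
    rw [Matrix.sub_mulVec, Matrix.one_mulVec, sub_eq_zero] at hXv
    have hk : ∀ k : ℕ, (X ^ k) *ᵥ v = v := by
      intro k
      induction k with
      | zero => simp
      | succ k ih => rw [pow_succ, ← Matrix.mulVec_mulVec, ← hXv, ih]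
    have ht : Tendsto (fun k => (X ^ k) *ᵥ v) atTop (𝓝 ((0 : Matrix (Idx d) (Idx d) ℂ) *ᵥ v)) :=
      ((continuous_id.matrix_mulVec continuous_const).tendsto 0).comp hlim
    simp only [hk, Matrix.zero_mulVec] at ht
    exact hv (tendsto_nhds_unique tendsto_const_nhds ht)
  refine ⟨hunit, fun a b => ?_⟩
  have hsum : ∀ k : ℕ, ∑ i ∈ Finset.range k, X ^ i = (1 - X)⁻¹ * (1 - X ^ k) := by
    intro k
    exact eq_inv_mul_of_mul_eq hunit (mul_neg_geom_sum X k)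
  have ht : Tendsto (fun k => (∑ i ∈ Finset.range k, X ^ i) a b) atTop (𝓝 ((1 - X)⁻¹ a b)) := by
    simp only [hsum]
    have : Tendsto (fun k => (1 - X)⁻¹ * (1 - X ^ k)) atTop (𝓝 ((1 - X)⁻¹ * (1 - 0))) :=
      ((continuous_const.matrix_mul (continuous_const.sub continuous_id)).tendsto 0).comp hlim
    rw [sub_zero, Matrix.mul_one] at this
    exact tendsto_pi_nhds.1 (tendsto_pi_nhds.1 this a) b
  refine le_of_tendsto ht.norm (Eventually.of_forall fun k => ?_)
  rw [Matrix.sum_apply]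
  calc _ ≤ ∑ i ∈ Finset.range k, (1 / 2 : ℝ) ^ i * ‖delayWeight G τ s a.1 b.1‖ :=
        norm_sum_le_of_le _ fun i _ => hpow i a b
    _ = (∑ i ∈ Finset.range k, (1 / 2 : ℝ) ^ i) * ‖delayWeight G τ s a.1 b.1‖ := by
        rw [Finset.sum_mul]
    _ ≤ _ := mul_le_mul_of_nonneg_right (sum_geometric_two_le k) (norm_nonneg _)

/-- A strictly proper structured perturbation of the identity has a structured inverse. -/
lemma structured_one_sub_inv_smul_inv (hτ : 0 ≤ τ) {X : ℂ → Matrix (Idx d) (Idx d) ℂ}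
    (hX : X ∈ structured G τ d d) :
    (∀ᶠ s in rightInfinity, IsUnit (1 - s⁻¹ • X s)) ∧
      (fun s => (1 - s⁻¹ • X s)⁻¹) ∈ structured G τ d d := by
  obtain ⟨α, hα, hd, c, hc⟩ := mem_structured_iff.1 hX
  -- For `‖s‖ > β` the entries of `s⁻¹ • X s` have constant `|c| / ‖s‖`, and `card * |c| / ‖s‖ ≤
  -- 1/2`.
  set β := max α (2 * (Fintype.card (Idx d) * |c|)) with hβ
  have hβ0 : 0 < β := lt_max_of_lt_left hα
  have h1 : halfPlane β ⊆ halfPlane α := halfPlane_subset (le_max_left _ _)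
  have hn : ∀ s ∈ halfPlane β, β < ‖s‖ := fun s hs => lt_of_lt_of_le hs (Complex.re_le_norm s)
  have key : ∀ s ∈ halfPlane β, IsUnit (1 - s⁻¹ • X s) ∧
      ∀ a b, ‖(1 - s⁻¹ • X s)⁻¹ a b‖ ≤ 2 * ‖delayWeight G τ s a.1 b.1‖ := by
    intro s hs
    have hs0 : 0 < ‖s‖ := hβ0.trans (hn s hs)
    refine isUnit_one_sub_and_norm_inv_le hτ (hα.trans (h1 hs)).le (c := ‖s‖⁻¹ * |c|)
      (by positivity) ?_ fun a b => ?_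
    · have : 2 * (Fintype.card (Idx d) * |c|) ≤ ‖s‖ := (le_max_right _ _).trans (hn s hs).le
      calc _ = (Fintype.card (Idx d) * |c|) / ‖s‖ := by ring
        _ ≤ 1 / 2 := by rw [div_le_iff₀ hs0]; linarith
    · rw [Matrix.smul_apply, smul_eq_mul, norm_mul, norm_inv, mul_assoc]
      refine mul_le_mul_of_nonneg_left ((hc s (h1 hs) a b).trans ?_) (by positivity)
      exact mul_le_mul_of_nonneg_right (le_abs_self _) (norm_nonneg _)
  refine ⟨eventually_rightInfinity.2 ⟨β, hβ0, fun s hs => (key s hs).1⟩,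
    mem_structured_iff.2 ⟨β, hβ0, ?_, 2, fun s hs => (key s hs).2⟩⟩
  refine differentiableOn_inv (fun i j => ?_) fun s hs => (key s hs).1
  simp only [Matrix.sub_apply, Matrix.smul_apply, smul_eq_mul]
  refine (differentiableOn_const _).sub ((differentiableOn_id.fun_inv fun s hs => ?_).mul
    ((hd i j).mono h1))
  exact norm_pos_iff.1 (hβ0.trans (hn s hs))

end Structured

end DelayControl

namespace DelayControl

/-! ### Closure properties of H∞ and stable resolvents. -/

section Hinf

variable {μ ν κ : Type*}

lemma IsHinf.congr {X Y : ℂ → Matrix μ ν ℂ} (hX : IsHinf X) (h : Y =ᶠ[rightInfinity] X) :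
    IsHinf Y := by
  obtain ⟨X', hX', hX⟩ := hX
  exact ⟨X', hX', h.trans hX⟩

lemma IsHinf.add {X Y : ℂ → Matrix μ ν ℂ} (hX : IsHinf X) (hY : IsHinf Y) :
    IsHinf fun s => X s + Y s := by
  obtain ⟨X', ⟨hd, c, hc⟩, hX⟩ := hX
  obtain ⟨Y', ⟨hd', c', hc'⟩, hY⟩ := hY
  refine ⟨fun s => X' s + Y' s, ⟨fun i j => (hd i j).add (hd' i j), c + c', fun s hs i j => ?_⟩, ?_⟩
  · exact norm_add_le_of_le (hc s hs i j) (hc' s hs i j)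
  · exact hX.add hY

lemma IsHinf.neg {X : ℂ → Matrix μ ν ℂ} (hX : IsHinf X) : IsHinf fun s => -X s := by
  obtain ⟨X', ⟨hd, c, hc⟩, hX⟩ := hX
  refine ⟨fun s => -X' s, ⟨fun i j => (hd i j).neg, c, fun s hs i j => ?_⟩, hX.neg⟩
  simpa using hc s hs i j

lemma IsHinf.sub {X Y : ℂ → Matrix μ ν ℂ} (hX : IsHinf X) (hY : IsHinf Y) :
    IsHinf fun s => X s - Y s := by
  simpa only [sub_eq_add_neg] using hX.add hY.neg

lemma isHinf_const [Finite μ] [Finite ν] (M : Matrix μ ν ℂ) : IsHinf fun _ => M := by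
  obtain ⟨c, hc⟩ := (Set.finite_range fun x : μ × ν => ‖M x.1 x.2‖).bddAbove
  exact ⟨fun _ => M, ⟨fun i j => differentiableOn_const _, c, fun s _ i j =>
    hc ⟨(i, j), rfl⟩⟩, EventuallyEq.rfl⟩

lemma IsHinf.mul [Fintype ν] {X : ℂ → Matrix μ ν ℂ} {Y : ℂ → Matrix ν κ ℂ} (hX : IsHinf X)
    (hY : IsHinf Y) : IsHinf fun s => X s * Y s := by
  obtain ⟨X', ⟨hd, c, hc⟩, hX⟩ := hX
  obtain ⟨Y', ⟨hd', c', hc'⟩, hY⟩ := hY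
  refine ⟨fun s => X' s * Y' s, ⟨fun i j => ?_, ∑ _k : ν, |c| * |c'|, fun s hs i j => ?_⟩, ?_⟩
  · simp only [Matrix.mul_apply]
    exact DifferentiableOn.fun_sum fun k _ => (hd i k).mul (hd' k j)
  · simp only [Matrix.mul_apply]
    refine norm_sum_le_of_le _ fun k _ => ?_
    rw [norm_mul]
    exact mul_le_mul ((hc s hs i k).trans (le_abs_self _)) ((hc' s hs k j).trans (le_abs_self _))
      (norm_nonneg _) (abs_nonneg _)
  · filter_upwards [hX, hY] with s h1 h2
    rw [h1, h2]

lemma IsHinf.submatrix {μ' ν' : Type*} {X : ℂ → Matrix μ ν ℂ} (hX : IsHinf X) (f : μ' → μ)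
    (g : ν' → ν) : IsHinf fun s => (X s).submatrix f g := by
  obtain ⟨X', ⟨hd, c, hc⟩, hX⟩ := hX
  refine ⟨fun s => (X' s).submatrix f g, ⟨fun i j => hd (f i) (g j), c, fun s hs i j =>
    hc s hs _ _⟩, ?_⟩
  filter_upwards [hX] with s h
  rw [h]

lemma IsHinf.fromRows {μ' : Type*} {X : ℂ → Matrix μ ν ℂ} {Y : ℂ → Matrix μ' ν ℂ}
    (hX : IsHinf X) (hY : IsHinf Y) : IsHinf fun s => fromRows (X s) (Y s) := by
  obtain ⟨X', ⟨hd, c, hc⟩, hX⟩ := hX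
  obtain ⟨Y', ⟨hd', c', hc'⟩, hY⟩ := hY
  refine ⟨fun s => Matrix.fromRows (X' s) (Y' s), ⟨?_, max c c', fun s hs => ?_⟩, ?_⟩
  · rintro (i | i) j
    exacts [hd i j, hd' i j]
  · rintro (i | i) j
    exacts [(hc s hs i j).trans (le_max_left _ _), (hc' s hs i j).trans (le_max_right _ _)]
  · filter_upwards [hX, hY] with s h1 h2
    rw [h1, h2]

lemma IsHinf.fromCols {ν' : Type*} {X : ℂ → Matrix μ ν ℂ} {Y : ℂ → Matrix μ ν' ℂ}
    (hX : IsHinf X) (hY : IsHinf Y) : IsHinf fun s => fromCols (X s) (Y s) := by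
  obtain ⟨X', ⟨hd, c, hc⟩, hX⟩ := hX
  obtain ⟨Y', ⟨hd', c', hc'⟩, hY⟩ := hY
  refine ⟨fun s => Matrix.fromCols (X' s) (Y' s), ⟨?_, max c c', fun s hs => ?_⟩, ?_⟩
  · rintro i (j | j)
    exacts [hd i j, hd' i j]
  · rintro i (j | j)
    exacts [(hc s hs i j).trans (le_max_left _ _), (hc' s hs i j).trans (le_max_right _ _)]
  · filter_upwards [hX, hY] with s h1 h2
    rw [h1, h2]

section Resolvent

attribute [local instance] Matrix.linftyOpNormedRing Matrix.linftyOpNormedAlgebra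

lemma tendsto_resolvent_apply {σ : Type*} [Fintype σ] [DecidableEq σ] (H : Matrix σ σ ℂ)
    (i j : σ) :
    Tendsto (fun s : ℂ => (s • (1 : Matrix σ σ ℂ) - H)⁻¹ i j) (Bornology.cobounded ℂ) (𝓝 0) := by
  have h := spectrum.resolvent_tendsto_cobounded (𝕜 := ℂ) H
  have h2 := ((continuous_id.matrix_elem i j).tendsto (0 : Matrix σ σ ℂ)).comp h
  refine h2.congr fun s => ?_
  simp [resolvent, Algebra.algebraMap_eq_smul_one, Matrix.nonsing_inv_eq_ringInverse]

end Resolvent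

/-- The resolvent of a Hurwitz matrix is in `H∞`. -/
lemma IsHurwitz.isHinf_resolvent {σ : Type*} [Fintype σ] [DecidableEq σ] {H : Matrix σ σ ℝ}
    (hH : IsHurwitz H) : IsHinf fun s => (s • (1 : Matrix σ σ ℂ) - toC H)⁻¹ := by
  -- The closed half-plane is used because its intersection with a closed ball is compact.
  have hunit : ∀ s ∈ {s : ℂ | 0 ≤ s.re}, IsUnit (s • (1 : Matrix σ σ ℂ) - toC H) := by
    intro s hs
    by_contra h
    refine absurd (hH s ?_) (not_lt.2 hs)
    rwa [spectrum.mem_iff, Algebra.algebraMap_eq_smul_one]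
  have hd : ∀ i j, DifferentiableOn ℂ (fun s => (s • (1 : Matrix σ σ ℂ) - toC H)⁻¹ i j)
      {s : ℂ | 0 ≤ s.re} := by
    refine differentiableOn_inv (fun i j => ?_) hunit
    simp only [Matrix.sub_apply, Matrix.smul_apply, smul_eq_mul]
    fun_prop
  have hb : ∀ i j, ∃ c : ℝ, ∀ s ∈ {s : ℂ | 0 ≤ s.re},
      ‖(s • (1 : Matrix σ σ ℂ) - toC H)⁻¹ i j‖ ≤ c := by
    intro i j
    -- The resolvent decays at infinity: its entries are at most `1` outside a ball and bounded by
    -- compactness inside.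
    have h1 := (tendsto_resolvent_apply (toC H) i j).norm.eventually_le_const
      (u := 1) (by simp)
    obtain ⟨r, -, hr⟩ := (Metric.hasBasis_cobounded_compl_closedBall (0 : ℂ)).eventually_iff.1 h1
    obtain ⟨c, hc⟩ := ((isCompact_closedBall (0 : ℂ) r).inter_right
      (isClosed_le continuous_const Complex.continuous_re)).exists_bound_of_continuousOn
      ((hd i j).continuousOn.mono Set.inter_subset_right)
    refine ⟨max c 1, fun s hs => ?_⟩
    by_cases h : s ∈ Metric.closedBall (0 : ℂ) r
    · exact (hc s ⟨h, hs⟩).trans (le_max_left _ _)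
    · exact (hr h).trans (le_max_right _ _)
  choose c hc using hb
  have hsub : halfPlane 0 ⊆ {s : ℂ | 0 ≤ s.re} := fun s hs =>
    le_of_lt (show 0 < s.re from hs)
  obtain ⟨c', hc'⟩ := (Set.finite_range fun x : σ × σ => c x.1 x.2).bddAbove
  exact ⟨_, ⟨fun i j => (hd i j).mono hsub, c', fun s hs i j =>
    (hc i j s (hsub hs)).trans (hc' ⟨(i, j), rfl⟩)⟩, EventuallyEq.rfl⟩

end Hinf

/-! ### State-space formulas for the plant and for `J`. -/

section Realization

variable {σ μ ν κ : Type*}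

lemma toC_add (X Y : Matrix μ ν ℝ) : toC (X + Y) = toC X + toC Y := by
  ext; simp [toC]

lemma toC_neg (X : Matrix μ ν ℝ) : toC (-X) = -toC X := by
  ext; simp [toC]

lemma toC_mul [Fintype ν] (X : Matrix μ ν ℝ) (Y : Matrix ν κ ℝ) :
    toC (X * Y) = toC X * toC Y := by
  ext; simp [toC, Matrix.mul_apply]

lemma toC_zero : toC (0 : Matrix μ ν ℝ) = 0 := by
  ext; simp [toC]

lemma toC_one [DecidableEq μ] : toC (1 : Matrix μ μ ℝ) = 1 := by
  ext i j; by_cases h : i = j <;> simp [toC, Matrix.one_apply, h]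

/-- The blocks of a transfer matrix with partitioned inputs and outputs. -/
lemma stateSpace_fromBlocks {μ' ν' : Type*} [Fintype σ] [DecidableEq σ] (A : Matrix σ σ ℝ)
    (B : Matrix σ ν ℝ) (B' : Matrix σ ν' ℝ) (C : Matrix μ σ ℝ) (C' : Matrix μ' σ ℝ)
    (D₁₁ : Matrix μ ν ℝ) (D₁₂ : Matrix μ ν' ℝ) (D₂₁ : Matrix μ' ν ℝ) (D₂₂ : Matrix μ' ν' ℝ)
    (s : ℂ) :
    stateSpace A (fromCols B B') (fromRows C C') (fromBlocks D₁₁ D₁₂ D₂₁ D₂₂) s =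
      fromBlocks (stateSpace A B C D₁₁ s) (stateSpace A B' C D₁₂ s)
        (stateSpace A B C' D₂₁ s) (stateSpace A B' C' D₂₂ s) := by
  have h1 : toC (fromCols B B') = fromCols (toC B) (toC B') := by
    ext i (j | j) <;> rfl
  have h2 : toC (fromRows C C') = fromRows (toC C) (toC C') := by
    ext (i | i) j <;> rfl
  have h3 : toC (fromBlocks D₁₁ D₁₂ D₂₁ D₂₂) =
      fromBlocks (toC D₁₁) (toC D₁₂) (toC D₂₁) (toC D₂₂) := fromBlocks_map ..
  simp only [stateSpace, h1, h2, h3, fromRows_mul, mul_fromCols, fromCols_fromRows_eq_fromBlocks,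
    fromBlocks_add]

variable {N : ℕ} {n m p q : Fin N → ℕ} {r : ℕ}

lemma Agents.plant_toBlocks₂₂ (S : Agents N n m p q r) (s : ℂ) :
    (S.plant s).toBlocks₂₂ = toC (blockDiagonal' S.C₂) *
      (s • (1 : Matrix (Idx n) (Idx n) ℂ) - toC (blockDiagonal' S.A))⁻¹ *
        toC (blockDiagonal' S.B₂) := by
  rw [Agents.plant, stateSpace_fromBlocks, toBlocks_fromBlocks₂₂, stateSpace, toC_zero, zero_add]

lemma Agents.lowerLFT_observerSystem (S : Agents N n m p q r) (F : Matrix (Idx m) (Idx n) ℝ)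
    (L : Matrix (Idx n) (Idx p) ℝ) (Q : ℂ → Matrix (Idx m) (Idx p) ℂ) (s : ℂ)
    {A : Matrix (Idx n) (Idx n) ℂ} {B : Matrix (Idx n) (Idx m) ℂ} {C : Matrix (Idx p) (Idx n) ℂ}
    {Ψ : Matrix (Idx n) (Idx n) ℂ}
    (hA : A = toC (blockDiagonal' S.A)) (hB : B = toC (blockDiagonal' S.B₂))
    (hC : C = toC (blockDiagonal' S.C₂))
    (hΨ : Ψ = (s • (1 : Matrix (Idx n) (Idx n) ℂ) - A - B * toC F - toC L * C)⁻¹) :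
    lowerLFT (S.observerSystem F L) Q s = -(toC F * Ψ * toC L) +
      (1 + toC F * Ψ * B) * Q s * (1 + C * Ψ * B * Q s)⁻¹ * (1 + C * Ψ * toC L) := by
  subst hA hB hC
  have h : s • (1 : Matrix (Idx n) (Idx n) ℂ) - toC (blockDiagonal' S.A +
      blockDiagonal' S.B₂ * F + L * blockDiagonal' S.C₂) = s • 1 - toC (blockDiagonal' S.A) -
      toC (blockDiagonal' S.B₂) * toC F - toC L * toC (blockDiagonal' S.C₂) := by
    simp only [toC_add, toC_mul]; abel
  rw [lowerLFT, Agents.observerSystem, stateSpace_fromBlocks, toBlocks_fromBlocks₁₁,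
    toBlocks_fromBlocks₁₂, toBlocks_fromBlocks₂₁, toBlocks_fromBlocks₂₂]
  simp only [stateSpace, h, ← hΨ, toC_neg, toC_zero, toC_one, zero_add, Matrix.neg_mul,
    Matrix.mul_neg, neg_neg, sub_neg_eq_add]

end Realization

end DelayControl

namespace DelayControl

/-! ### Well-posed structured feedback. -/

section Feedback

variable {N : ℕ} {G : Digraph (Fin N)} {τ : ℝ} {d e f : Fin N → ℕ}

lemma eventually_ne_zero_rightInfinity : ∀ᶠ s in rightInfinity, s ≠ 0 :=
  eventually_rightInfinity.2 ⟨1, one_pos, fun s hs h => by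
    subst h
    exact absurd (show (1 : ℝ) < (0 : ℂ).re from hs) (by simp)⟩

/-- The resolvent of a structured constant matrix is structured and strictly proper. -/
lemma exists_structured_resolvent (hτ : 0 ≤ τ) {M : Matrix (Idx d) (Idx d) ℂ}
    (hM : (fun _ => M) ∈ structured G τ d d) :
    (∀ᶠ s in rightInfinity, IsUnit (s • (1 : Matrix (Idx d) (Idx d) ℂ) - M)) ∧
      ∃ R ∈ structured G τ d d, ∀ᶠ s in rightInfinity,
        (s • (1 : Matrix (Idx d) (Idx d) ℂ) - M)⁻¹ = s⁻¹ • R s := by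
  -- Uses `sI - M = s (I - s⁻¹ M)`, with `R = (I - s⁻¹ M)⁻¹`.
  obtain ⟨hu, hR⟩ := structured_one_sub_inv_smul_inv hτ hM
  have key : ∀ᶠ s in rightInfinity, (s • (1 : Matrix (Idx d) (Idx d) ℂ) - M) *
      (s⁻¹ • (1 - s⁻¹ • M)⁻¹) = 1 := by
    filter_upwards [hu, eventually_ne_zero_rightInfinity] with s hs h0
    have h1 : s • (1 : Matrix (Idx d) (Idx d) ℂ) - M = s • (1 - s⁻¹ • M) := by
      rw [smul_sub, smul_smul, mul_inv_cancel₀ h0, one_smul]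
    rw [h1, Matrix.smul_mul, Matrix.mul_smul, smul_smul, mul_inv_cancel₀ h0, one_smul,
      Matrix.mul_nonsing_inv _ ((Matrix.isUnit_iff_isUnit_det _).1 hs)]
  refine ⟨?_, _, hR, ?_⟩
  · filter_upwards [key] with s hs
    exact IsUnit.of_mul_eq_one _ hs
  · filter_upwards [key] with s hs
    exact Matrix.inv_eq_right_inv hs

lemma structured_resolvent (hτ : 0 ≤ τ) {M : Matrix (Idx d) (Idx d) ℂ}
    (hM : (fun _ => M) ∈ structured G τ d d) :
    (fun s => (s • (1 : Matrix (Idx d) (Idx d) ℂ) - M)⁻¹) ∈ structured G τ d d := by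
  obtain ⟨-, R, hR, h⟩ := exists_structured_resolvent hτ hM
  exact structured_congr h (structured_inv_smul hR)

/-- Feedback around a strictly proper structured system is well posed and structured. -/
lemma structured_feedback (hτ : 0 ≤ τ) {M : Matrix (Idx d) (Idx d) ℂ}
    (hM : (fun _ => M) ∈ structured G τ d d) {B : Matrix (Idx d) (Idx e) ℂ}
    (hB : (fun _ => B) ∈ structured G τ d e) {C : Matrix (Idx f) (Idx d) ℂ}
    (hC : (fun _ => C) ∈ structured G τ f d) {X : ℂ → Matrix (Idx e) (Idx f) ℂ}
    (hX : X ∈ structured G τ e f) :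
    (∀ᶠ s in rightInfinity,
      IsUnit (1 - C * (s • (1 : Matrix (Idx d) (Idx d) ℂ) - M)⁻¹ * B * X s)) ∧
    (fun s => (1 - C * (s • (1 : Matrix (Idx d) (Idx d) ℂ) - M)⁻¹ * B * X s)⁻¹) ∈
      structured G τ f f := by
  obtain ⟨-, R, hR, h⟩ := exists_structured_resolvent hτ hM
  -- The resolvent contributes the factor `s⁻¹` that makes the loop gain strictly proper.
  have hW := structured_mul hτ (structured_mul hτ (structured_mul hτ hC hR) hB) hX
  obtain ⟨hu, hI⟩ := structured_one_sub_inv_smul_inv hτ hW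
  have heq : ∀ᶠ s in rightInfinity,
      1 - C * (s • (1 : Matrix (Idx d) (Idx d) ℂ) - M)⁻¹ * B * X s =
        1 - s⁻¹ • (C * R s * B * X s) := by
    filter_upwards [h] with s hs
    rw [hs]
    simp only [Matrix.mul_smul, Matrix.smul_mul]
  constructor
  · filter_upwards [heq, hu] with s h1 h2
    rwa [h1]
  · refine structured_congr ?_ hI
    filter_upwards [heq] with s h1
    rw [h1]

end Feedback

end DelayControl

/-! ### The parametrization. -/

open DelayControl

theorem lemma1 {N : ℕ} {n m p q : Fin N → ℕ} {r : ℕ}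
    (S : DelayControl.Agents N n m p q r) (hS : S.SystemAssumptions)
    (G : Digraph (Fin N)) (τ : ℝ) (hτ : 0 ≤ τ)
    (F : ∀ i, Matrix (Fin (m i)) (Fin (n i)) ℝ)
    (L : ∀ i, Matrix (Fin (n i)) (Fin (p i)) ℝ)
    (hF : DelayControl.IsHurwitz
      (Matrix.blockDiagonal' S.A + Matrix.blockDiagonal' S.B₂ * Matrix.blockDiagonal' F))
    (hL : DelayControl.IsHurwitz
      (Matrix.blockDiagonal' S.A + Matrix.blockDiagonal' L * Matrix.blockDiagonal' S.C₂))
    (K : ℂ → Matrix (DelayControl.Idx m) (DelayControl.Idx p) ℂ) :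
    (K ∈ DelayControl.structured G τ m p ∧ DelayControl.Stabilizes K S.plant) ↔
      ∃ Q : ℂ → Matrix (DelayControl.Idx m) (DelayControl.Idx p) ℂ,
        DelayControl.IsHinf Q ∧ Q ∈ DelayControl.structured G τ m p ∧
        K =ᶠ[DelayControl.rightInfinity] DelayControl.lowerLFT
          (S.observerSystem (Matrix.blockDiagonal' F) (Matrix.blockDiagonal' L)) Q := by
  have hsA := structured_blockDiagonal' (G := G) (τ := τ) S.A
  have hsB := structured_blockDiagonal' (G := G) (τ := τ) S.B₂
  have hsC := structured_blockDiagonal' (G := G) (τ := τ) S.C₂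
  have hsF := structured_blockDiagonal' (G := G) (τ := τ) F
  have hsL := structured_blockDiagonal' (G := G) (τ := τ) L
  have hΦF := hF.isHinf_resolvent
  have hΦL := hL.isHinf_resolvent
  have hlft := fun Q s => S.lowerLFT_observerSystem (blockDiagonal' F) (blockDiagonal' L) Q s
    rfl rfl rfl rfl
  simp only [toC_add, toC_mul] at hΦF hΦL
  simp only [Stabilizes, S.plant_toBlocks₂₂]
  generalize toC (blockDiagonal' S.A) = A at *
  generalize toC (blockDiagonal' S.B₂) = B at *
  generalize toC (blockDiagonal' S.C₂) = C at *
  generalize toC (blockDiagonal' F) = F' at *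
  generalize toC (blockDiagonal' L) = L' at *
  simp only [← sub_sub] at hΦF hΦL
  have hcB := isHinf_const B
  have hcC := isHinf_const C
  have hcF := isHinf_const F'
  have hcL := isHinf_const L'
  have hcI := isHinf_const (1 : Matrix (Idx p) (Idx p) ℂ)
  have hcI' := isHinf_const (1 : Matrix (Idx m) (Idx m) ℂ)
  have hsJ := structured_add (structured_add hsA (structured_mul hτ hsB hsF))
    (structured_mul hτ hsL hsC)
  have uA := (exists_structured_resolvent hτ hsA).1
  have uF := (exists_structured_resolvent hτ (structured_add hsA (structured_mul hτ hsB hsF))).1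
  have uL := (exists_structured_resolvent hτ (structured_add hsA (structured_mul hτ hsL hsC))).1
  have uJ := (exists_structured_resolvent hτ hsJ).1
  have hsR := structured_resolvent hτ hsA
  have hsΨ := structured_resolvent hτ hsJ
  simp only [← sub_sub] at uF uL uJ hsΨ
  -- `J₂₂ = -CΨB` with `Ψ` the resolvent of `J`, so the loop is closed with `-Q`.
  have feedbackJ : ∀ Q ∈ structured G τ m p,
      (∀ᶠ s in rightInfinity, IsUnit (1 + C * (s • (1 : Matrix (Idx n) (Idx n) ℂ) - A - B * F' -
        L' * C)⁻¹ * B * Q s)) ∧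
      (fun s => (1 + C * (s • (1 : Matrix (Idx n) (Idx n) ℂ) - A - B * F' -
        L' * C)⁻¹ * B * Q s)⁻¹) ∈ structured G τ p p := by
    intro Q hQ
    simpa only [Matrix.mul_neg, sub_neg_eq_add, ← sub_sub] using
      structured_feedback hτ hsJ hsB hsC (structured_neg hQ)
  constructor
  · rintro ⟨hK, hTu, hT⟩
    obtain ⟨uGK, hsGK⟩ := structured_feedback hτ hsA hsB hsC hK
    -- Responses `y` and `x` to a unit innovation; the parameter is `Ky - F'x`.
    obtain ⟨y, hy⟩ : ∃ y : ℂ → Matrix (Idx p) (Idx p) ℂ, ∀ s, y s =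
      (1 - C * (s • 1 - A)⁻¹ * B * K s)⁻¹ * (1 - C * (s • 1 - A)⁻¹ * L') := ⟨_, fun _ => rfl⟩
    obtain ⟨x, hx⟩ : ∃ x : ℂ → Matrix (Idx n) (Idx p) ℂ, ∀ s, x s =
      (s • 1 - A)⁻¹ * (B * (K s * y s) - L') := ⟨_, fun _ => rfl⟩
    have hloop : ∀ᶠ s in rightInfinity, ObserverLoop (s • 1 - A) B C F' L' (K s) (x s) (y s)
        (K s * y s - F' * x s) := by
      filter_upwards [uA, uGK] with s h1 h2
      exact observerLoop_of_isUnit h1 h2 (hy s) (hx s) rfl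
    have hsy : y ∈ structured G τ p p := by
      rw [show y = _ from funext hy]
      exact structured_mul hτ hsGK (structured_sub structured_one
        (structured_mul hτ (structured_mul hτ hsC hsR) hsL))
    have hsx : x ∈ structured G τ n p := by
      rw [show x = _ from funext hx]
      exact structured_mul hτ hsR (structured_sub
        (structured_mul hτ hsB (structured_mul hτ hK hsy)) hsL)
    have hsQ : (fun s => K s * y s - F' * x s) ∈ structured G τ m p :=
      structured_sub (structured_mul hτ hK hsy) (structured_mul hτ hsF hsx)
    have hY := (hcF.mul hΦF).mul hcL
    have hrows := hT.mul ((hcI.sub ((hcC.mul hΦF).mul hcL)).fromRows hY)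
    have hyH : IsHinf y := by
      refine (hrows.submatrix Sum.inl id).congr ?_
      filter_upwards [hloop, uA, uF, hTu] with s h h1 h2 h3
      rw [h.fromBlocks_inv_mul h1 h2 h3]
      rfl
    have hKyH : IsHinf fun s => K s * y s := by
      refine ((hrows.submatrix Sum.inr id).sub hY).congr ?_
      filter_upwards [hloop, uA, uF, hTu] with s h h1 h2 h3
      rw [h.fromBlocks_inv_mul h1 h2 h3]
      exact (add_sub_cancel_right _ _).symm
    -- The defining formula for `x` contains the possibly unstable `(sI - A)⁻¹`; the estimator form
    -- avoids it.
    have hxH : IsHinf x := by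
      refine (hΦL.mul ((hcB.mul hKyH).sub (hcL.mul hyH))).congr ?_
      filter_upwards [hloop, uL] with s h h1
      exact h.state_eq_estimator h1
    refine ⟨_, hKyH.sub (hcF.mul hxH), hsQ, ?_⟩
    filter_upwards [hloop, uJ, (feedbackJ _ hsQ).1] with s h h1 h2
    rw [hlft]
    exact h.controller_eq h1 h2
  · rintro ⟨Q, hQ, hsQ, hK⟩
    obtain ⟨uQ, hsI⟩ := feedbackJ Q hsQ
    -- In this inverse neither the resolvent of `A` nor that of `J` occurs, so every block is in H∞.
    have hinv : ∀ᶠ s in rightInfinity,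
        fromBlocks 1 (-(C * (s • 1 - A)⁻¹ * B)) (-K s) 1 *
          fromBlocks
            ((1 + C * (s • 1 - A - B * F')⁻¹ * (B * Q s - L')) *
              (1 + C * (s • 1 - A - L' * C)⁻¹ * L'))
            ((1 + C * (s • 1 - A - B * F')⁻¹ * (B * Q s - L')) *
              (C * (s • 1 - A - L' * C)⁻¹ * B))
            ((F' * (s • 1 - A - B * F')⁻¹ * (B * Q s - L') + Q s) *
              (1 + C * (s • 1 - A - L' * C)⁻¹ * L'))
            (1 + (F' * (s • 1 - A - B * F')⁻¹ * (B * Q s - L') + Q s) *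
              (C * (s • 1 - A - L' * C)⁻¹ * B)) = 1 := by
      filter_upwards [hK, uA, uF, uL, uJ, uQ] with s h h1 h2 h3 h4 h5
      rw [hlft] at h
      exact fromBlocks_mul_closedLoop h1 h2 h3 h4 h5 h rfl rfl
    have hV := (hcB.mul hQ).sub hcL
    have hD := hcI.add ((hcC.mul hΦF).mul hV)
    have hU := ((hcF.mul hΦF).mul hV).add hQ
    have hM := hcI.add ((hcC.mul hΦL).mul hcL)
    have hN := (hcC.mul hΦL).mul hcB
    refine ⟨structured_congr hK ?_, ?_, ?_⟩
    · rw [show lowerLFT _ Q = _ from funext (hlft Q)]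
      refine structured_add (structured_neg (structured_mul hτ (structured_mul hτ hsF hsΨ) hsL))
        (structured_mul hτ (structured_mul hτ (structured_mul hτ (structured_add structured_one
          (structured_mul hτ (structured_mul hτ hsF hsΨ) hsB)) hsQ) hsI)
          (structured_add structured_one (structured_mul hτ (structured_mul hτ hsC hsΨ) hsL)))
    · filter_upwards [hinv] with s h
      exact IsUnit.of_mul_eq_one _ h
    · refine (((hD.mul hM).fromCols (hD.mul hN)).fromRows
        ((hU.mul hM).fromCols (hcI'.add (hU.mul hN)))).congr ?_
      filter_upwards [hinv] with s h
      rw [Matrix.inv_eq_right_inv h, fromRows_fromCols_eq_fromBlocks]
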